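/- Let $m\ge 1$ and let $\mathrm{FI}^m$ be the category whose objects are the $m$-tuples $\mathbf n=([n_1],\dots,[n_m])$ with $n_i\in\mathbb{N}$ (where $[n]=\{1,\dots,n\}$ and $[0]=\emptyset$) and whose morphisms $\mathbf n\to\mathbf t$ are the $m$-tuples of injections $[n_i]\to[t_i]$. An $\mathrm{FI}^m$-module over a commutative ring $k$ is a covariant functor $V$ from $\mathrm{FI}^m$ to the category of $k$-modules; it is finitely generated if there is a finite set $S$ of elements of $\bigsqcup_{\mathbf n}V_{\mathbf n}$ such that the only submodule of $V$ containing $S$ is $V$ itself. The finitistic dimension of $k$ is $$\operatorname{fdim} k=\sup\{\operatorname{pd}_k(T)\mid T\text{ is a finitely generated } k\text{-module with }\operatorname{pd}_k(T)<\infty\}.$$ Let $k$ be a commutative Noetherian ring with $\operatorname{fdim} k=0$, and let $V$ be a finitely generated $\mathrm{FI}^m$-module over $k$. Then $V$ has finite projective dimension in the abelian category of all $\mathrm{FI}^m$-modules over $k$ if and only if $V$ is a projective object of that category. -/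

import Mathlib

open CategoryTheory

universe u

/-- Objects of (the skeleton of) the category `FI`: the object with `card = n` stands for
the finite set `[n]` with `n` elements. -/
structure FI : Type where
  card : ℕ

/-- Morphisms `[a] ⟶ [b]` in `FI` are the injections `[a] → [b]`. -/
instance FI.category : Category.{0} FI where
  Hom a b := Fin a.card ↪ Fin b.card
  id a := Function.Embedding.refl (Fin a.card)
  comp f g := f.trans g

/-- The category `FI^m`, the product of `m` copies of `FI`: its objects are `m`-tuples
`([n₁], …, [nₘ])` and its morphisms are `m`-tuples of injections. -/
abbrev FIPow (m : ℕ) : Type := Fin m → FI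

/-- `FI^m`-modules over `k`: covariant functors from `FI^m` to `k`-modules. -/
abbrev FIModule (m : ℕ) (k : Type u) [CommRing k] : Type (u + 1) :=
  FIPow m ⥤ ModuleCat.{u} k

namespace FIModule

variable {m : ℕ} {k : Type u} [CommRing k]

/-- A submodule of an `FI^m`-module `V`: a submodule of each value `V_n`, such that these
are stable under the maps that the morphisms of `FI^m` induce. -/
structure Sub (V : FIModule m k) where
  carrier : ∀ n : FIPow m, Submodule k (V.obj n)
  map_mem : ∀ {n t : FIPow m} (f : n ⟶ t) (v : V.obj n),
    v ∈ carrier n → V.map f v ∈ carrier t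

/-- `V` is finitely generated if it has a finite set `S` of elements such that every
submodule containing `S` coincides with `V`. -/
def IsFinitelyGenerated (V : FIModule m k) : Prop :=
  ∃ S : Set (Σ n : FIPow m, V.obj n), S.Finite ∧
    ∀ W : Sub V, (∀ s ∈ S, s.2 ∈ W.carrier s.1) → ∀ n : FIPow m, W.carrier n = ⊤

end FIModule

/-- The finitistic dimension of a commutative (Noetherian) ring `k`: the supremum of the
projective dimensions of the finitely generated `k`-modules of finite projective dimension.
The projective dimension of the zero module, which is `⊥` in Mathlib, is counted as `0` here;
this is only visible if `k` is the zero ring. -/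
noncomputable def finitisticDimension (k : Type u) [CommRing k] : ℕ∞ :=
  ⨆ (T : ModuleCat.{u} k) (_ : Module.Finite k T) (_ : projectiveDimension T < ⊤),
    (projectiveDimension T).unbotD 0

/-! Cover `V` by a pointwise finite free module `F` with kernel `K`. By induction on the projective
dimension, `K` is projective. At each object `c` this leaves `V c` with projective dimension at most
one, hence projective because the finitistic dimension of `k` is zero. So `K ⟶ F` splits at every
object, and it remains to split it functorially.

For free modules, pass to the quotient by the part generated in smaller degree (`lower`). A
pointwise split map stays injective on these quotients modulo every maximal ideal `q`
(`coord_mem_of_coord_app_mem`). To see this, push `x` along the `N ^ deg c` maps `spread` from `c`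
into its blow-up. The coordinates at generators of smaller degree number only `O(N ^ (deg c - 1))`,
so for large `N` some combination of the copies, nonzero modulo `q`, kills them all modulo `q`. The
pointwise retraction at the blow-up then carries the vanishing back to `x`.

Injectivity modulo all `q` gives a linear retraction on each quotient. The quotients are free over
`k[Aut c]`, so it can be made equivariant without dividing by the group order
(`exists_average_eq_self`). Its values on generators define a natural map that retracts modulo
`lower`, and a unipotence argument corrects it (`isIso_of_sub_mem_lower`). Projectives reduce to
free modules by adding a complement. -/

open Limits

/-! ### Tuples of injections and blow-ups -/

namespace FIPow

variable {m : ℕ}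

/-- The total number of elements of an object of `FI^m`. -/
def deg (c : FIPow m) : ℕ := ∑ i, (c i).card

/-- The injection underlying a component of a morphism of `FI^m`. -/
def emb {a b : FIPow m} (f : a ⟶ b) (i : Fin m) : Fin (a i).card ↪ Fin (b i).card := f i

lemma hom_ext' {a b : FIPow m} {f g : a ⟶ b} (h : ∀ i x, emb f i x = emb g i x) : f = g := by
  funext i
  exact Function.Embedding.ext (h i)

@[simp] lemma emb_comp {a b c : FIPow m} (f : a ⟶ b) (g : b ⟶ c) (i : Fin m)
    (x : Fin (a i).card) : emb (f ≫ g) i x = emb g i (emb f i x) := rfl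

@[simp] lemma emb_id (a : FIPow m) (i : Fin m) (x : Fin (a i).card) : emb (𝟙 a) i x = x := rfl

instance finite_hom (a b : FIPow m) : Finite (a ⟶ b) :=
  inferInstanceAs (Finite (∀ i, Fin (a i).card ↪ Fin (b i).card))

lemma card_le {a b : FIPow m} (f : a ⟶ b) (i : Fin m) : (a i).card ≤ (b i).card := by
  simpa using Fintype.card_le_of_embedding (emb f i)

lemma deg_le {a b : FIPow m} (f : a ⟶ b) : deg a ≤ deg b :=
  Finset.sum_le_sum fun i _ => card_le f i

lemma eq_of_deg_le {a b : FIPow m} (f : a ⟶ b) (h : deg b ≤ deg a) : a = b := by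
  have h1 := (Finset.sum_eq_sum_iff_of_le fun i _ => card_le f i).1 (le_antisymm (deg_le f) h)
  funext i
  have h2 := h1 i (Finset.mem_univ i)
  cases hi : a i; cases hj : b i
  simpa [hi, hj] using h2

instance mono_hom {a b : FIPow m} (f : a ⟶ b) : Mono f :=
  ⟨fun g h e => hom_ext' fun i x => (emb f i).injective (by
    rw [← emb_comp, ← emb_comp, e])⟩

instance isIso_endo {a : FIPow m} (f : a ⟶ a) : IsIso f := by
  have hb : ∀ i, Function.Bijective (emb f i) := fun i =>
    Finite.injective_iff_bijective.1 (emb f i).injective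
  let g : a ⟶ a := fun i => (Equiv.ofBijective _ (hb i)).symm.toEmbedding
  have hg : ∀ i x, emb g i x = (Equiv.ofBijective _ (hb i)).symm x := fun _ _ => rfl
  refine ⟨g, hom_ext' fun i x => ?_, hom_ext' fun i x => ?_⟩
  · rw [emb_comp, hg, emb_id]
    exact (Equiv.ofBijective _ (hb i)).symm_apply_apply x
  · rw [emb_comp, hg, emb_id]
    exact (Equiv.ofBijective _ (hb i)).apply_symm_apply x

instance finite_aut (a : FIPow m) : Finite (Aut a) :=
  Finite.of_injective (fun g : Aut a => g.hom) fun _ _ h => Iso.ext h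

instance finite_over (b : FIPow m) : Finite {a : FIPow m // Nonempty (a ⟶ b)} := by
  let F : {a : FIPow m // Nonempty (a ⟶ b)} → ∀ i, Fin ((b i).card + 1) :=
    fun a i => ⟨(a.1 i).card, Nat.lt_succ_of_le (card_le a.2.some i)⟩
  refine Finite.of_injective F fun a a' h => Subtype.ext (funext fun i => ?_)
  have h1 := congrArg Fin.val (congrFun h i)
  cases hi : a.1 i; cases hj : a'.1 i
  simpa [F, hi, hj] using h1

/-- The object with `N` times as many elements in each component. -/
def blowUp (c : FIPow m) (N : ℕ) : FIPow m := fun i => ⟨(c i).card * N⟩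

/-- The map `c ⟶ blowUp c N` that sends `x` to the element number `a x` of the block of `x`. -/
def spread (c : FIPow m) (N : ℕ) (a : ∀ i, Fin (c i).card → Fin N) : c ⟶ blowUp c N :=
  fun i => ⟨fun x => finProdFinEquiv (x, a i x), fun x y h => by
    simpa using congrArg Prod.fst (finProdFinEquiv.injective h)⟩

lemma emb_spread (c : FIPow m) (N : ℕ) (a : ∀ i, Fin (c i).card → Fin N) (i : Fin m)
    (x : Fin (c i).card) : emb (spread c N a) i x = finProdFinEquiv (x, a i x) := rfl

lemma eq_of_comp_spread_eq {c b : FIPow m} {N : ℕ} {a a' : ∀ i, Fin (c i).card → Fin N}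
    {g g' : b ⟶ c} (h : g ≫ spread c N a = g' ≫ spread c N a') :
    g = g' ∧ ∀ i x, a i (emb g i x) = a' i (emb g i x) := by
  have h1 : ∀ i x, (emb g i x, a i (emb g i x)) = (emb g' i x, a' i (emb g' i x)) := fun i x => by
    have h2 : emb (g ≫ spread c N a) i x = emb (g' ≫ spread c N a') i x := by rw [h]
    rw [emb_comp, emb_comp, emb_spread, emb_spread] at h2
    exact finProdFinEquiv.injective h2
  have h3 : g = g' := hom_ext' fun i x => congrArg Prod.fst (h1 i x)
  subst h3
  exact ⟨rfl, fun i x => congrArg Prod.snd (h1 i x)⟩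

/-- An endomorphism is surjective, so it tests the offsets `a` at every point. Hence different
spreads send top-degree basis elements to disjoint sets of basis elements. -/
lemma eq_of_endo_comp_spread_eq {c : FIPow m} {N : ℕ} {a a' : ∀ i, Fin (c i).card → Fin N}
    {g g' : c ⟶ c} (h : g ≫ spread c N a = g' ≫ spread c N a') : g = g' ∧ a = a' := by
  obtain ⟨h1, h2⟩ := eq_of_comp_spread_eq h
  refine ⟨h1, funext fun i => funext fun x => ?_⟩
  obtain ⟨y, rfl⟩ := (Finite.injective_iff_bijective.1 (emb g i).injective).2 x
  exact h2 i y

lemma card_spread (c : FIPow m) (N : ℕ) :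
    Nat.card (∀ i, Fin (c i).card → Fin N) = N ^ deg c := by
  simp [deg, Finset.prod_pow_eq_pow_sum]

lemma card_hom_blowUp_le (e c : FIPow m) (N : ℕ) :
    Nat.card (e ⟶ blowUp c N) ≤ (∏ i, (c i).card ^ (e i).card) * N ^ deg e := by
  have h : Nat.card (e ⟶ blowUp c N) ≤ Nat.card (∀ i, Fin (e i).card → Fin ((c i).card * N)) :=
    Nat.card_le_card_of_injective (fun f i x => emb f i x) fun f g h =>
      hom_ext' fun i x => congrFun (congrFun h i) x
  refine h.trans (le_of_eq ?_)
  simp [mul_pow, Finset.prod_mul_distrib, deg, Finset.prod_pow_eq_pow_sum]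

end FIPow

/-! ### Free modules and pointwise finite covers -/

namespace FIModule

open FIPow

variable {m : ℕ} {k : Type u} [CommRing k]

section free

variable {I : Type u}

/-- The natural basis of the value at `c` of the free module with generators in degrees `d i`. -/
abbrev Gen (d : I → FIPow m) (c : FIPow m) : Type u := Σ i, (d i ⟶ c)

/-- The induced map on basis elements. -/
def Gen.map {d : I → FIPow m} {a c : FIPow m} (f : a ⟶ c) (b : Gen d a) : Gen d c :=
  ⟨b.1, b.2 ≫ f⟩

variable (k) in
/-- The free `FI^m`-module with generators in degrees `d i`. -/
noncomputable def free (d : I → FIPow m) : FIModule m k where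
  obj c := ModuleCat.of k (Gen d c →₀ k)
  map f := ModuleCat.ofHom (Finsupp.lmapDomain k k (Gen.map f))
  map_id c := by
    ext : 1
    refine Finsupp.lhom_ext' fun b => LinearMap.ext_ring ?_
    simp [Gen.map]
  map_comp f g := by
    ext : 1
    refine Finsupp.lhom_ext' fun b => LinearMap.ext_ring ?_
    simp [Gen.map]

variable {d : I → FIPow m}

/-- The basis elements of a free module. -/
noncomputable def basisElt {c : FIPow m} (b : Gen d c) : (free k d).obj c :=
  Finsupp.single b (1 : k)

/-- The generators of a free module. -/
noncomputable def gen (i : I) : (free k d).obj (d i) := basisElt ⟨i, 𝟙 _⟩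

/-- The coordinates of an element of a free module. -/
def coord {c : FIPow m} (x : (free k d).obj c) : Gen d c →₀ k := x

@[simp] lemma map_basisElt {a c : FIPow m} (f : a ⟶ c) (b : Gen d a) :
    (free k d).map f (basisElt b) = basisElt (b.map f) :=
  Finsupp.mapDomain_single

lemma map_gen {i : I} {c : FIPow m} (f : d i ⟶ c) :
    (free k d).map f (gen i) = basisElt ⟨i, f⟩ := by
  simp [gen, Gen.map]

lemma hom_ext_basisElt {c : FIPow m} {M : Type*} [AddCommGroup M] [Module k M]
    {f g : (free k d).obj c →ₗ[k] M} (h : ∀ b, f (basisElt b) = g (basisElt b)) : f = g :=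
  Finsupp.lhom_ext' fun b => LinearMap.ext_ring (h b)

lemma sum_coord {c : FIPow m} [Fintype (Gen d c)]
    (x : (free k d).obj c) : x = ∑ b, coord x b • basisElt b := by
  conv_lhs => rw [show x = (coord x).sum Finsupp.single from (Finsupp.sum_single (coord x)).symm]
  rw [Finsupp.sum_fintype _ _ (by simp)]
  exact Finset.sum_congr rfl fun b _ => by
    simp only [basisElt]
    exact (Finsupp.smul_single_one b _).symm

/-- The homomorphism out of a free module with prescribed values on the generators. -/
noncomputable def desc (V : FIModule m k) (v : ∀ i, V.obj (d i)) : free k d ⟶ V where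
  app c := ModuleCat.ofHom (Finsupp.lsum k fun b : Gen d c =>
    LinearMap.toSpanSingleton k (V.obj c) (V.map b.2 (v b.1)))
  naturality a c f := by
    ext : 1
    refine hom_ext_basisElt fun b => ?_
    change Finsupp.lsum k _ ((free k d).map f (basisElt b)) =
      V.map f (Finsupp.lsum k _ (basisElt b))
    rw [map_basisElt]
    simp [basisElt, Gen.map]

@[simp] lemma desc_basisElt (V : FIModule m k) (v : ∀ i, V.obj (d i)) {c : FIPow m}
    (b : Gen d c) : (desc V v).app c (basisElt b) = V.map b.2 (v b.1) := by
  change Finsupp.lsum k _ (Finsupp.single b (1 : k)) = _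
  simp

@[simp] lemma desc_gen (V : FIModule m k) (v : ∀ i, V.obj (d i)) (i : I) :
    (desc V v).app (d i) (gen i) = v i := by
  simp [gen]

lemma free_hom_ext {V : FIModule m k} {f g : free k d ⟶ V}
    (h : ∀ i, f.app (d i) (gen i) = g.app (d i) (gen i)) : f = g := by
  ext c : 2
  ext : 1
  refine hom_ext_basisElt fun b => ?_
  obtain ⟨i, b⟩ := b
  rw [← map_gen]
  have h1 := NatTrans.naturality_apply f b (gen i)
  have h2 := NatTrans.naturality_apply g b (gen i)
  exact h1.trans ((congrArg _ (h i)).trans h2.symm)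

instance free_projective : Projective (free k d) where
  factors {E X} f e he := by
    have h : ∀ c, Function.Surjective (e.app c) := fun c => by
      have := (NatTrans.epi_iff_epi_app e).1 he c
      exact (ModuleCat.epi_iff_surjective _).1 this
    choose v hv using fun i => h (d i) (f.app (d i) (gen i))
    exact ⟨desc E v, free_hom_ext fun i => by simp [hv]⟩

end free

/-- An `FI^m`-module all of whose values are finitely generated. -/
def PointwiseFinite (V : FIModule m k) : Prop := ∀ c, Module.Finite k (V.obj c)

lemma free_pointwiseFinite {I : Type u} {d : I → FIPow m} [∀ c, Finite (Gen d c)] :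
    PointwiseFinite (free k d) :=
  fun c => inferInstanceAs (Module.Finite k (Gen d c →₀ k))

/-- Hom sets are finite, so the finitely many generators have finitely many images in each value,
and these images span a submodule containing the generators. -/
lemma IsFinitelyGenerated.pointwiseFinite {V : FIModule m k} (hV : V.IsFinitelyGenerated) :
    PointwiseFinite V := by
  obtain ⟨S, hS, h⟩ := hV
  have := hS.to_subtype
  let F (c : FIPow m) : (Σ s : S, (s.1.1 ⟶ c)) → V.obj c := fun p => V.map p.2 p.1.1.2
  let W : Sub V :=
    { carrier := fun c => Submodule.span k (Set.range (F c))
      map_mem := fun {a c} f v hv => by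
        induction hv using Submodule.span_induction with
        | mem x hx =>
          obtain ⟨p, rfl⟩ := hx
          exact Submodule.subset_span ⟨⟨p.1, p.2 ≫ f⟩, by simp [F]⟩
        | zero => simp
        | add x y _ _ hx hy => rw [map_add]; exact add_mem hx hy
        | smul r x _ hx => rw [map_smul]; exact Submodule.smul_mem _ _ hx }
  intro c
  refine ⟨?_⟩
  rw [← h W (fun s hs => Submodule.subset_span ⟨⟨⟨s, hs⟩, 𝟙 _⟩, by simp [F]⟩) c]
  exact Submodule.fg_span (Set.finite_range _)

/-- A pointwise finite `FI^m`-module is a quotient of a pointwise finite free one. -/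
lemma PointwiseFinite.exists_cover {V : FIModule m k} (hV : PointwiseFinite V) :
    ∃ (I : Type u) (d : I → FIPow m) (_ : ∀ c, Finite (Gen d c)) (p : free k d ⟶ V), Epi p := by
  choose S hS using fun c => (hV c).fg_top
  let d : (Σ c : FIPow m, S c) → FIPow m := Sigma.fst
  refine ⟨_, d, fun c => ?_, desc (d := d) V fun i => (i.2.1 : V.obj i.1), ?_⟩
  · let F : Gen d c → Σ a : {a : FIPow m // Nonempty (a ⟶ c)}, S a.1 × (a.1 ⟶ c) :=
      fun b => ⟨⟨b.1.1, ⟨b.2⟩⟩, (b.1.2, b.2)⟩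
    refine Finite.of_injective F ?_
    rintro ⟨⟨a, s⟩, f⟩ ⟨⟨a', s'⟩, f'⟩ h
    simp only [F, Sigma.mk.injEq, Subtype.mk.injEq] at h
    obtain ⟨rfl, h⟩ := h
    simp only [heq_eq_eq, Prod.mk.injEq] at h
    obtain ⟨rfl, rfl⟩ := h
    rfl
  · rw [NatTrans.epi_iff_epi_app]
    intro c
    rw [ModuleCat.epi_iff_surjective]
    change Function.Surjective ((desc (d := d) V fun i => (i.2.1 : V.obj i.1)).app c).hom
    rw [← LinearMap.range_eq_top, eq_top_iff, ← hS c, Submodule.span_le]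
    intro v hv
    exact ⟨basisElt ⟨⟨c, v, hv⟩, 𝟙 _⟩, by simp⟩

end FIModule

/-! ### Linear algebra modulo maximal ideals -/

/-- A linear map between finite free modules that is injective modulo every maximal ideal has
a left inverse. -/
lemma LinearMap.exists_leftInverse_of_injective_mod_maximal {k : Type*} [CommRing k]
    {T S : Type*} [Finite T] [Finite S] (φ : (T → k) →ₗ[k] (S → k))
    (h : ∀ q : Ideal k, q.IsMaximal → ∀ w, (∀ s, φ w s ∈ q) → ∀ t, w t ∈ q) :
    ∃ L : (S → k) →ₗ[k] (T → k), L ∘ₗ φ = LinearMap.id := by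
  classical
  have := Fintype.ofFinite T
  have := Fintype.ofFinite S
  let row (s : S) : T → k := fun t => φ (Pi.single t 1) s
  have hφ (w : T → k) (s : S) : φ w s = ∑ t, w t * row s t := by
    conv_lhs => rw [show w = ∑ t, w t • Pi.single t (1 : k) from
      (pi_eq_sum_univ' w).trans (by simp)]
    simp [row]
  -- If the rows of the matrix failed to span, they would lie in a maximal submodule with quotient
  -- `k ⧸ q`. The quotient map is pairing with some `w`, so `φ w` vanishes modulo `q`, hence so does
  -- `w`, and the quotient map would be zero.
  have hR : Submodule.span k (Set.range row) = ⊤ := by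
    by_contra hne
    obtain ⟨X, hX, hle⟩ :=
      (eq_top_or_exists_le_coatom (Submodule.span k (Set.range row))).resolve_left hne
    have hs : IsSimpleModule k ((T → k) ⧸ X) := isSimpleModule_iff_isCoatom.2 hX
    obtain ⟨q, hq, ⟨E⟩⟩ := isSimpleModule_iff_quot_maximal.1 hs
    let ev : (T → k) →ₗ[k] k ⧸ q := E.toLinearMap ∘ₗ X.mkQ
    choose w hw using fun t => Ideal.Quotient.mk_surjective (ev (Pi.single t 1))
    have hev (v : T → k) : ev v = Ideal.Quotient.mk q (∑ t, v t * w t) := by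
      conv_lhs => rw [show v = ∑ t, v t • Pi.single t (1 : k) from
        (pi_eq_sum_univ' v).trans (by simp)]
      simp only [map_sum, map_smul, ← hw, map_mul]
      rfl
    have h1 : ∀ t, w t ∈ q := h q hq w fun s => by
      have h2 : ev (row s) = 0 := by
        have : row s ∈ X := hle (Submodule.subset_span ⟨s, rfl⟩)
        simp [ev, this]
      rw [hev, Ideal.Quotient.eq_zero_iff_mem] at h2
      rw [hφ]
      simpa [mul_comm] using h2
    refine hX.1 (eq_top_iff.2 fun v _ => ?_)
    have h3 : ev v = 0 := by
      rw [hev, Ideal.Quotient.eq_zero_iff_mem]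
      exact q.sum_mem fun t _ => q.mul_mem_left _ (h1 t)
    simpa [ev] using h3
  have hc (t : T) : ∃ c : S → k, ∑ s, c s • row s = Pi.single t 1 :=
    (Submodule.mem_span_range_iff_exists_fun k).1 (by rw [hR]; trivial)
  choose c hc using hc
  refine ⟨LinearMap.pi fun t => ∑ s, c t s • LinearMap.proj s, ?_⟩
  ext t' : 1
  refine LinearMap.ext_ring (funext fun t => ?_)
  have h4 := congrFun (hc t) t'
  simp only [Finset.sum_apply, Pi.smul_apply, smul_eq_mul, row] at h4
  simp [h4, Pi.single_apply, eq_comm]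

/-- Over the field `k ⧸ q`, a homogeneous system with fewer equations than unknowns has a nonzero
solution. -/
lemma exists_combination_mem {k : Type*} [CommRing k] (q : Ideal k) [hq : q.IsMaximal]
    {A L : Type*} [Fintype A] [Finite L] (hlt : Nat.card L < Nat.card A) (M : A → L → k) :
    ∃ t : A → k, (∃ a, t a ∉ q) ∧ ∀ l, ∑ a, t a * M a l ∈ q := by
  have := Fintype.ofFinite L
  let := Ideal.Quotient.field q
  let f : (A → k ⧸ q) →ₗ[k ⧸ q] (L → k ⧸ q) :=
    LinearMap.pi fun l => ∑ a, Ideal.Quotient.mk q (M a l) • LinearMap.proj a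
  have hf : LinearMap.ker f ≠ ⊥ := LinearMap.ker_ne_bot_of_finrank_lt (by
    simpa [Module.finrank_fintype_fun_eq_card, ← Nat.card_eq_fintype_card] using hlt)
  obtain ⟨v, hv, hv0⟩ := (Submodule.ne_bot_iff _).1 hf
  choose t ht using fun a => Ideal.Quotient.mk_surjective (v a)
  refine ⟨t, ?_, fun l => ?_⟩
  · by_contra! hall
    exact hv0 (funext fun a => by
      rw [← ht, Ideal.Quotient.eq_zero_iff_mem.2 (hall a)]; rfl)
  · have h1 := congrFun (LinearMap.mem_ker.1 hv) l
    rw [← Ideal.Quotient.eq_zero_iff_mem]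
    simpa [f, ← ht, mul_comm] using h1

/-! ### The counting argument on blow-ups -/

namespace FIModule

open FIPow

variable {m : ℕ} {k : Type u} [CommRing k] {I J : Type u} {d : I → FIPow m} {e : J → FIPow m}

lemma Gen.map_injective {a c : FIPow m} (f : a ⟶ c) :
    Function.Injective (Gen.map (d := d) f) := by
  rintro ⟨i, g⟩ ⟨i', g'⟩ h
  simp only [Gen.map, Sigma.mk.injEq] at h
  obtain ⟨rfl, h⟩ := h
  rw [heq_eq_eq, cancel_mono] at h
  rw [h]

lemma coord_map_apply {a c : FIPow m} (f : a ⟶ c) (x : (free k d).obj a) (b : Gen d a) :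
    coord ((free k d).map f x) (b.map f) = coord x b :=
  Finsupp.mapDomain_apply (Gen.map_injective f) _ _

lemma coord_map_of_notMem_range {a c : FIPow m} (f : a ⟶ c) (x : (free k d).obj a)
    (b : Gen d c) (hb : b ∉ Set.range (Gen.map f)) : coord ((free k d).map f x) b = 0 :=
  Finsupp.mapDomain_of_notMem_range _ _ hb

/-- Taking a coordinate, as a linear map. -/
noncomputable def coordₗ {c : FIPow m} (b : Gen d c) : (free k d).obj c →ₗ[k] k :=
  Finsupp.lapply b

lemma coordₗ_apply {c : FIPow m} (b : Gen d c) (x : (free k d).obj c) :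
    coordₗ b x = coord x b := rfl

lemma coord_mem_of_forall_coord_mem [∀ c, Finite (Gen e c)] {c : FIPow m}
    (r : (free k e).obj c →ₗ[k] (free k d).obj c) (q : Ideal k) (y : (free k e).obj c)
    (hy : ∀ b, coord y b ∈ q) (b : Gen d c) : coord (r y) b ∈ q := by
  have := Fintype.ofFinite (Gen e c)
  rw [sum_coord y, ← coordₗ_apply, map_sum, map_sum]
  exact q.sum_mem fun b' _ => by
    rw [map_smul, map_smul]
    exact q.mul_mem_right _ (hy b')

/-- The basis elements of `(free k e).obj n` from generators of degree below `c`. -/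
abbrev LowGen (e : J → FIPow m) (c n : FIPow m) : Type u :=
  {b : Gen e n // deg (e b.1) < deg c ∧ Nonempty (e b.1 ⟶ c)}

lemma exists_card_lowGen_lt (e : J → FIPow m) [∀ c, Finite (Gen e c)] (c : FIPow m) :
    ∃ N, Nat.card (LowGen e c (blowUp c N)) < N ^ deg c := by
  let J' := {j : J // deg (e j) < deg c ∧ Nonempty (e j ⟶ c)}
  have : Finite J' := Finite.of_injective (β := Gen e c) (fun j => ⟨j.1, j.2.2.some⟩)
    fun j j' h => Subtype.ext (congrArg Sigma.fst h)
  have := Fintype.ofFinite J'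
  let K (j : J') : ℕ := ∏ i, (c i).card ^ (e j.1 i).card
  -- Any `N` exceeding the sum of the constants works; `h1`, `h2` and `h3` compare both sides after
  -- multiplication by `N`.
  refine ⟨∑ j, K j + 1, ?_⟩
  set N := ∑ j, K j + 1 with hN
  have h1 : Nat.card (LowGen e c (blowUp c N)) ≤
      Nat.card (Σ j : J', (e j.1 ⟶ blowUp c N)) := by
    refine Nat.card_le_card_of_injective (fun b => ⟨⟨b.1.1, b.2⟩, b.1.2⟩) ?_
    rintro ⟨⟨j, f⟩, hb⟩ ⟨⟨j', f'⟩, hb'⟩ h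
    obtain rfl : j = j' := congrArg (fun p => p.1.1) h
    simpa using h
  have h2 : Nat.card (Σ j : J', (e j.1 ⟶ blowUp c N)) * N ≤ (∑ j, K j) * N ^ deg c := by
    rw [Nat.card_sigma, Finset.sum_mul, Finset.sum_mul]
    refine Finset.sum_le_sum fun j _ => ?_
    calc _ ≤ (K j * N ^ deg (e j.1)) * N := Nat.mul_le_mul_right _ (card_hom_blowUp_le _ _ _)
      _ = K j * N ^ (deg (e j.1) + 1) := by ring
      _ ≤ _ := Nat.mul_le_mul_left _ (Nat.pow_le_pow_right (by omega) j.2.1)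
  have h3 : (∑ j, K j) * N ^ deg c < N ^ deg c * N := by
    rw [mul_comm]
    exact Nat.mul_lt_mul_of_pos_left (by omega) (by positivity)
  exact lt_of_mul_lt_mul_right (((Nat.mul_le_mul_right N h1).trans h2).trans_lt h3) (Nat.zero_le N)

/-- If a pointwise split map of free modules sends `x` to an element whose coordinates at the
generators of top degree lie in a maximal ideal, then so do those of `x`. -/
lemma coord_mem_of_coord_app_mem [∀ c, Finite (Gen e c)] (Φ : free k d ⟶ free k e)
    (hΦ : ∀ c, ∃ r : (free k e).obj c →ₗ[k] (free k d).obj c, ∀ x, r (Φ.app c x) = x)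
    (q : Ideal k) [hq : q.IsMaximal] {c : FIPow m} (x : (free k d).obj c)
    (hx : ∀ b : Gen e c, deg (e b.1) = deg c → coord (Φ.app c x) b ∈ q)
    (b : Gen d c) (hb : deg (d b.1) = deg c) : coord x b ∈ q := by
  classical
  obtain ⟨N, hN⟩ := exists_card_lowGen_lt e c
  obtain ⟨t, ⟨a, ha⟩, ht⟩ := exists_combination_mem q (A := ∀ i, Fin (c i).card → Fin N)
    (hN.trans_eq (card_spread c N).symm)
    (fun a (l : LowGen e c (blowUp c N)) => coord ((free k e).map (spread c N a) (Φ.app c x)) l.1)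
  let z : (free k d).obj (blowUp c N) := ∑ a, t a • (free k d).map (spread c N a) x
  have hz (b : Gen e (blowUp c N)) : coord (Φ.app _ z) b =
      ∑ a, t a * coord ((free k e).map (spread c N a) (Φ.app c x)) b := by
    simp only [← coordₗ_apply, z, map_sum, map_smul, smul_eq_mul]
    refine Finset.sum_congr rfl fun a _ => ?_
    rw [NatTrans.naturality_apply]
  have hmem (b : Gen e (blowUp c N)) : coord (Φ.app _ z) b ∈ q := by
    rw [hz]
    by_cases hl : deg (e b.1) < deg c ∧ Nonempty (e b.1 ⟶ c)
    · exact ht ⟨b, hl⟩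
    -- For such `b`, each copy contributes either zero, if `b` is not in the image of the spread, or
    -- a coordinate of `Φ x` at a generator of degree exactly `deg c`, covered by `hx`.
    · refine q.sum_mem fun a _ => q.mul_mem_left _ ?_
      by_cases hr : b ∈ Set.range (Gen.map (spread c N a))
      · obtain ⟨b', rfl⟩ := hr
        rw [coord_map_apply]
        have h1 := deg_le b'.2
        have h2 : ¬ deg (e b'.1) < deg c := fun h => hl ⟨h, ⟨b'.2⟩⟩
        exact hx _ (by omega)
      · rw [coord_map_of_notMem_range _ _ _ hr]
        exact q.zero_mem
  obtain ⟨r, hr⟩ := hΦ (blowUp c N)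
  have h1 := coord_mem_of_forall_coord_mem r q _ hmem (b.map (spread c N a))
  rw [hr] at h1
  -- Only the copy indexed by `a` meets this basis element, so the unit `t a` modulo `q` can be
  -- cancelled.
  have h2 : coord z (b.map (spread c N a)) = t a * coord x b := by
    simp only [← coordₗ_apply, z, map_sum, map_smul, smul_eq_mul]
    rw [Finset.sum_eq_single a]
    · rw [coordₗ_apply, coord_map_apply]; rfl
    · intro a' _ hne
      rw [coordₗ_apply, coord_map_of_notMem_range, mul_zero]
      rintro ⟨⟨i', g'⟩, h⟩
      obtain ⟨i, g⟩ := b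
      simp only [Gen.map, Sigma.mk.injEq] at h
      obtain ⟨rfl, h⟩ := h
      obtain rfl := eq_of_deg_le g hb.ge
      exact hne (eq_of_endo_comp_spread_eq (eq_of_heq h)).2
    · simp
  rw [h2] at h1
  exact (hq.isPrime.mem_or_mem h1).resolve_left ha

end FIModule

/-! ### Splitting modulo smaller degrees and lifting the splitting -/

namespace FIModule

open FIPow

variable {m : ℕ} {k : Type u} [CommRing k] {I J : Type u} {d : I → FIPow m} {e : J → FIPow m}

/-- The part of `V.obj c` that comes from objects of smaller degree. -/
def lower (V : FIModule m k) (c : FIPow m) : Submodule k (V.obj c) :=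
  Submodule.span k {x | ∃ (a : FIPow m) (f : a ⟶ c) (v : V.obj a), deg a < deg c ∧ V.map f v = x}

lemma map_mem_lower_of_lt (V : FIModule m k) {a c : FIPow m} (f : a ⟶ c) (v : V.obj a)
    (h : deg a < deg c) : V.map f v ∈ lower V c :=
  Submodule.subset_span ⟨a, f, v, h, rfl⟩

lemma app_mem_lower {V W : FIModule m k} (φ : V ⟶ W) {c : FIPow m} {x : V.obj c}
    (hx : x ∈ lower V c) : φ.app c x ∈ lower W c := by
  change x ∈ (lower W c).comap (φ.app c).hom
  refine Submodule.span_le.2 ?_ hx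
  rintro _ ⟨a, f, v, h, rfl⟩
  change φ.app c (V.map f v) ∈ lower W c
  rw [NatTrans.naturality_apply]
  exact map_mem_lower_of_lt W f _ h

lemma map_mem_lower (V : FIModule m k) {a c : FIPow m} (g : a ⟶ c) {x : V.obj a}
    (hx : x ∈ lower V a) : V.map g x ∈ lower V c := by
  change x ∈ (lower V c).comap (V.map g).hom
  refine Submodule.span_le.2 ?_ hx
  rintro _ ⟨a, f, v, h, rfl⟩
  change V.map g (V.map f v) ∈ lower V c
  rw [← ConcreteCategory.comp_apply, ← V.map_comp]
  exact map_mem_lower_of_lt V _ _ (h.trans_le (deg_le g))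

lemma basisElt_mem_lower {c : FIPow m} (b : Gen d c) (h : deg (d b.1) < deg c) :
    (basisElt b : (free k d).obj c) ∈ lower (free k d) c := by
  obtain ⟨i, f⟩ := b
  rw [← map_gen]
  exact map_mem_lower_of_lt _ f _ h

lemma coord_eq_zero_of_mem_lower {c : FIPow m} {x : (free k d).obj c}
    (hx : x ∈ lower (free k d) c) (b : Gen d c) (hb : deg (d b.1) = deg c) : coord x b = 0 := by
  change x ∈ LinearMap.ker (coordₗ b)
  refine Submodule.span_le.2 ?_ hx
  rintro _ ⟨a, f, v, h, rfl⟩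
  refine coord_map_of_notMem_range f v b ?_
  rintro ⟨b', rfl⟩
  exact absurd (deg_le b'.2) (not_le.2 (h.trans_eq hb.symm))

lemma mem_lower_of_coord_eq_zero [∀ c, Finite (Gen d c)] {c : FIPow m} {x : (free k d).obj c}
    (hx : ∀ b : Gen d c, deg (d b.1) = deg c → coord x b = 0) : x ∈ lower (free k d) c := by
  have := Fintype.ofFinite (Gen d c)
  rw [sum_coord x]
  refine Submodule.sum_mem _ fun b _ => ?_
  rcases (deg_le b.2).lt_or_eq with h | h
  · exact Submodule.smul_mem _ _ (basisElt_mem_lower b h)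
  · rw [hx b h, zero_smul]
    exact Submodule.zero_mem _

/-- The basis elements of top degree. -/
abbrev TopGen (d : I → FIPow m) (c : FIPow m) : Type u := {b : Gen d c // deg (d b.1) = deg c}

/-- The coordinates at the basis elements of top degree. -/
noncomputable def topCoord (k : Type u) [CommRing k] (d : I → FIPow m) (c : FIPow m) :
    (free k d).obj c →ₗ[k] (TopGen d c → k) :=
  LinearMap.pi fun b => coordₗ b.1

lemma coord_basisElt_self {c : FIPow m} (b : Gen d c) :
    coord (basisElt b : (free k d).obj c) b = 1 := Finsupp.single_eq_same

lemma coord_basisElt_of_ne {c : FIPow m} {b b' : Gen d c} (h : b' ≠ b) :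
    coord (basisElt b : (free k d).obj c) b' = 0 := Finsupp.single_eq_of_ne h

lemma exists_topCoord_section [∀ c, Finite (Gen d c)] (c : FIPow m) :
    ∃ s : (TopGen d c → k) →ₗ[k] (free k d).obj c, ∀ w, topCoord k d c (s w) = w := by
  classical
  have := Fintype.ofFinite (TopGen d c)
  refine ⟨Fintype.linearCombination k fun b : TopGen d c => basisElt b.1,
    fun w => funext fun b => ?_⟩
  rw [Fintype.linearCombination_apply, map_sum, Finset.sum_apply, Finset.sum_eq_single b]
  · simp [topCoord, coordₗ_apply, coord_basisElt_self]
  · intro b' _ hne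
    have h : b.1 ≠ b'.1 := fun h => hne (Subtype.ext h.symm)
    simp [topCoord, coordₗ_apply, coord_basisElt_of_ne h]
  · simp

lemma mem_lower_iff [∀ c, Finite (Gen d c)] {c : FIPow m} {x : (free k d).obj c} :
    x ∈ lower (free k d) c ↔ topCoord k d c x = 0 :=
  ⟨fun h => funext fun b => coord_eq_zero_of_mem_lower h b.1 b.2,
    fun h => mem_lower_of_coord_eq_zero fun b hb => congrFun h ⟨b, hb⟩⟩

lemma pow_app_map {V : FIModule m k} (N : V ⟶ V) {a c : FIPow m} (f : a ⟶ c) (s : ℕ)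
    (v : V.obj a) : ((N.app c).hom ^ s) (V.map f v) = V.map f (((N.app a).hom ^ s) v) := by
  induction s generalizing v with
  | zero => rfl
  | succ s ih =>
    rw [pow_succ, pow_succ, Module.End.mul_apply, Module.End.mul_apply, ← ih]
    exact congrArg _ (NatTrans.naturality_apply N f v)

/-- Each application of `N` lands in images of objects of strictly smaller degree, and naturality
moves the remaining powers there. -/
lemma pow_app_eq_zero {V : FIModule m k} (N : V ⟶ V)
    (hN : ∀ (c : FIPow m) (x : V.obj c), N.app c x ∈ lower V c) (s : ℕ) (c : FIPow m)
    (hc : deg c < s) : (N.app c).hom ^ s = 0 := by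
  induction s generalizing c with
  | zero => omega
  | succ s ih =>
    ext x
    rw [pow_succ, Module.End.mul_apply]
    change (N.app c).hom x ∈ LinearMap.ker ((N.app c).hom ^ s)
    refine Submodule.span_le.2 ?_ (hN c x)
    rintro _ ⟨a, f, v, h, rfl⟩
    change ((N.app c).hom ^ s) (V.map f v) = 0
    rw [pow_app_map, ih a (by omega), LinearMap.zero_apply, map_zero]

/-- An endomorphism that is the identity modulo elements from smaller degrees is invertible. -/
lemma isIso_of_sub_mem_lower {V : FIModule m k} (M : V ⟶ V)
    (hM : ∀ (c : FIPow m) (x : V.obj c), M.app c x - x ∈ lower V c) : IsIso M := by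
  rw [NatTrans.isIso_iff_isIso_app]
  intro c
  have h := pow_app_eq_zero (𝟙 V - M) (fun c x => by
    rw [← neg_mem_iff]
    convert hM c x using 1
    simp) _ c (Nat.lt_succ_self _)
  have h1 : IsUnit (M.app c).hom := by
    have h2 := IsNilpotent.isUnit_one_sub ⟨_, h⟩
    have h3 : (1 : Module.End k (V.obj c)) - ((𝟙 V - M).app c).hom = (M.app c).hom :=
      LinearMap.ext fun x => by simp
    exact h3 ▸ h2
  rw [Module.End.isUnit_iff] at h1
  exact (ConcreteCategory.isIso_iff_bijective _).2 h1

variable [∀ c, Finite (Gen d c)] [∀ c, Finite (Gen e c)]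

/-- The top coordinates identify the quotient by `lower` with a finite free `k`-module. The counting
argument is exactly the injectivity hypothesis of the left inverse criterion for the induced map. -/
lemma exists_retraction_mod_lower (Φ : free k d ⟶ free k e)
    (hΦ : ∀ c, ∃ r : (free k e).obj c →ₗ[k] (free k d).obj c, ∀ x, r (Φ.app c x) = x)
    (c : FIPow m) :
    ∃ ρ : (free k e).obj c →ₗ[k] (free k d).obj c,
      (∀ y ∈ lower (free k e) c, ρ y ∈ lower (free k d) c) ∧
      ∀ x, ρ (Φ.app c x) - x ∈ lower (free k d) c := by
  obtain ⟨s, hs⟩ := exists_topCoord_section (k := k) (d := d) c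
  obtain ⟨L, hL⟩ := (topCoord k e c ∘ₗ (Φ.app c).hom ∘ₗ
    s).exists_leftInverse_of_injective_mod_maximal fun q hq w hw b => by
      have h := coord_mem_of_coord_app_mem Φ hΦ q (s w) (fun b hb => hw ⟨b, hb⟩) b.1 b.2
      rwa [show coord (s w) b.1 = w b from congrFun (hs w) b] at h
  refine ⟨s ∘ₗ L ∘ₗ topCoord k e c, fun y hy => ?_, fun x => ?_⟩
  · simp [mem_lower_iff.1 hy]
  · have h1 : x - s (topCoord k d c x) ∈ lower (free k d) c := by
      rw [mem_lower_iff, map_sub, hs, sub_self]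
    have h2 := mem_lower_iff.1 (app_mem_lower Φ h1)
    rw [map_sub, map_sub, sub_eq_zero] at h2
    rw [mem_lower_iff, map_sub, sub_eq_zero, LinearMap.comp_apply, LinearMap.comp_apply, hs, h2]
    exact LinearMap.congr_fun hL (topCoord k d c x)

/-- `Aut c` permutes the top basis elements freely, and `ε` keeps only those that are generators
themselves. The conjugate of `ε` by `g` keeps those with morphism `g`, so the conjugates sum to the
identity modulo `lower`. -/
lemma exists_average_eq_self (c : FIPow m) [Fintype (Aut c)] :
    ∃ ε : (free k d).obj c →ₗ[k] (free k d).obj c,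
      (∀ x ∈ lower (free k d) c, ε x ∈ lower (free k d) c) ∧
      ∀ x, ∑ g : Aut c, (free k d).map g.hom (ε ((free k d).map g.inv x)) - x ∈
        lower (free k d) c := by
  classical
  let ε : (free k d).obj c →ₗ[k] (free k d).obj c :=
    Finsupp.lsum k fun b : Gen d c => LinearMap.toSpanSingleton k ((free k d).obj c)
      (if ∃ h : d b.1 = c, b.2 = eqToHom h then basisElt b else 0)
  have hε (b : Gen d c) : ε (basisElt b) =
      if ∃ h : d b.1 = c, b.2 = eqToHom h then basisElt b else 0 := by
    change Finsupp.lsum k _ (Finsupp.single b (1 : k)) = _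
    simp
  have hlow : ∀ x ∈ lower (free k d) c, ε x ∈ lower (free k d) c := by
    intro x hx
    have := Fintype.ofFinite (Gen d c)
    rw [sum_coord x, map_sum]
    refine Submodule.sum_mem _ fun b _ => ?_
    rw [map_smul]
    rcases (deg_le b.2).lt_or_eq with h | h
    · rw [hε]
      split_ifs
      · exact Submodule.smul_mem _ _ (basisElt_mem_lower b h)
      · simp
    · rw [coord_eq_zero_of_mem_lower hx b h, zero_smul]
      exact Submodule.zero_mem _
  refine ⟨ε, hlow, fun x => ?_⟩
  let T : (free k d).obj c →ₗ[k] (free k d).obj c :=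
    ∑ g : Aut c, ((free k d).map g.hom).hom ∘ₗ ε ∘ₗ ((free k d).map g.inv).hom
  have hT (x) : T x = ∑ g : Aut c, (free k d).map g.hom (ε ((free k d).map g.inv x)) := by
    simp [T]
  rw [← hT, ← Submodule.Quotient.mk_eq_zero, Submodule.Quotient.mk_sub, sub_eq_zero]
  refine LinearMap.congr_fun (f := (lower (free k d) c).mkQ ∘ₗ T)
    (g := (lower (free k d) c).mkQ) (hom_ext_basisElt fun b => ?_) x
  rw [LinearMap.comp_apply, ← sub_eq_zero, ← map_sub, Submodule.mkQ_apply,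
    Submodule.Quotient.mk_eq_zero, hT]
  rcases (deg_le b.2).lt_or_eq with h | h
  · exact Submodule.sub_mem _ (Submodule.sum_mem _ fun g _ => map_mem_lower _ _
      (hlow _ (map_mem_lower _ _ (basisElt_mem_lower b h)))) (basisElt_mem_lower b h)
  · convert Submodule.zero_mem _
    rw [sub_eq_zero]
    obtain ⟨i, f⟩ := b
    obtain rfl := eq_of_deg_le f h.ge
    have h1 (g : d i ≅ d i) : (∃ h : d i = d i, f ≫ g.inv = eqToHom h) ↔ g = asIso f := by
      rw [exists_prop_of_true rfl, eqToHom_refl, Iso.comp_inv_eq, Category.id_comp, Iso.ext_iff,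
        eq_comm, asIso_hom]
    let f' : Aut (d i) := asIso f
    have key (g : Aut (d i)) : (free k d).map g.hom (ε ((free k d).map g.inv (basisElt ⟨i, f⟩))) =
        if g = f' then basisElt ⟨i, f⟩ else 0 := by
      rw [map_basisElt, hε]
      by_cases hg : g = f'
      · refine (congrArg _ (if_pos ((h1 g).2 hg))).trans ?_
        rw [if_pos hg, map_basisElt]
        simp only [Gen.map, Category.assoc]
        rw [show g.inv ≫ g.hom = 𝟙 (d i) from g.inv_hom_id, Category.comp_id]
      · refine (congrArg _ (if_neg fun h => hg ((h1 g).1 h))).trans ?_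
        rw [if_neg hg, map_zero]
    calc _ = ∑ g : Aut (d i), if g = f' then (basisElt ⟨i, f⟩ : (free k d).obj (d i)) else 0 :=
          Finset.sum_congr rfl fun g _ => key g
      _ = _ := by
        rw [Finset.sum_ite_eq']
        exact if_pos (Finset.mem_univ _)

/-- Summing the conjugates of `ε ∘ σ`, for a linear retraction `σ`, gives an equivariant map. Since
`Φ` is natural and `σ` inverts it modulo `lower`, composing with `Φ` leaves the sum of conjugates of
`ε`, the identity modulo `lower`. -/
lemma exists_equivariant_retraction_mod_lower (Φ : free k d ⟶ free k e)
    (hΦ : ∀ c, ∃ r : (free k e).obj c →ₗ[k] (free k d).obj c, ∀ x, r (Φ.app c x) = x)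
    (c : FIPow m) :
    ∃ ρ : (free k e).obj c →ₗ[k] (free k d).obj c,
      (∀ y ∈ lower (free k e) c, ρ y ∈ lower (free k d) c) ∧
      (∀ x, ρ (Φ.app c x) - x ∈ lower (free k d) c) ∧
      ∀ (f : c ⟶ c) (y), ρ ((free k e).map f y) = (free k d).map f (ρ y) := by
  have := Fintype.ofFinite (Aut c)
  obtain ⟨σ, hσ, hσΦ⟩ := exists_retraction_mod_lower Φ hΦ c
  obtain ⟨ε, hε, hεs⟩ := exists_average_eq_self (k := k) (d := d) c
  let ρ : (free k e).obj c →ₗ[k] (free k d).obj c :=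
    ∑ g : Aut c, ((free k d).map g.hom).hom ∘ₗ ε ∘ₗ σ ∘ₗ ((free k e).map g.inv).hom
  have hρ (y) : ρ y = ∑ g : Aut c, (free k d).map g.hom (ε (σ ((free k e).map g.inv y))) := by
    simp [ρ]
  refine ⟨ρ, fun y hy => ?_, fun x => ?_, fun f y => ?_⟩
  · rw [hρ]
    exact Submodule.sum_mem _ fun g _ =>
      map_mem_lower _ _ (hε _ (hσ _ (map_mem_lower _ _ hy)))
  · have h : ρ (Φ.app c x) - x =
        ∑ g : Aut c, (free k d).map g.hom (ε (σ (Φ.app c ((free k d).map g.inv x)) -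
          (free k d).map g.inv x)) +
        (∑ g : Aut c, (free k d).map g.hom (ε ((free k d).map g.inv x)) - x) := by
      rw [hρ, ← add_sub_assoc, ← Finset.sum_add_distrib]
      congr 1
      refine Finset.sum_congr rfl fun g _ => ?_
      rw [map_sub, map_sub, sub_add_cancel, NatTrans.naturality_apply]
    rw [h]
    exact Submodule.add_mem _ (Submodule.sum_mem _ fun g _ => map_mem_lower _ _
      (hε _ (hσΦ _))) (hεs x)
  · rw [hρ, hρ, map_sum]
    let h : Aut c := asIso f
    refine (Fintype.sum_equiv (Equiv.mulLeft h) _ _ fun g => ?_).symm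
    have h1 : (Equiv.mulLeft h g).hom = g.hom ≫ f := rfl
    have h2 : f ≫ (Equiv.mulLeft h g).inv = g.inv := by
      change f ≫ h.inv ≫ g.inv = g.inv
      rw [← Category.assoc, show f ≫ h.inv = 𝟙 c from h.hom_inv_id, Category.id_comp]
    rw [h1, ← ConcreteCategory.comp_apply ((free k e).map f), ← Functor.map_comp, h2,
      Functor.map_comp, ConcreteCategory.comp_apply]

/-- A pointwise split monomorphism of pointwise finite free modules splits. -/
theorem isSplitMono_of_pointwise_free (Φ : free k d ⟶ free k e)
    (hΦ : ∀ c, ∃ r : (free k e).obj c →ₗ[k] (free k d).obj c, ∀ x, r (Φ.app c x) = x) :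
    ∃ R : free k e ⟶ free k d, Φ ≫ R = 𝟙 _ := by
  choose ρ hlow hΦρ hequiv using exists_equivariant_retraction_mod_lower Φ hΦ
  let R : free k e ⟶ free k d := desc _ fun j => ρ (e j) (gen j)
  -- `R` and `ρ c` agree modulo `lower`: both preserve it, and on top-degree basis elements, which
  -- are translates of generators by automorphisms, equivariance forces equality.
  have hR (c : FIPow m) (y : (free k e).obj c) : R.app c y - ρ c y ∈ lower (free k d) c := by
    rw [← Submodule.Quotient.mk_eq_zero, Submodule.Quotient.mk_sub, sub_eq_zero]
    refine LinearMap.congr_fun (f := (lower (free k d) c).mkQ ∘ₗ (R.app c).hom)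
      (g := (lower (free k d) c).mkQ ∘ₗ ρ c) (hom_ext_basisElt fun b => ?_) y
    rw [LinearMap.comp_apply, LinearMap.comp_apply, ← sub_eq_zero, ← map_sub,
      Submodule.mkQ_apply, Submodule.Quotient.mk_eq_zero]
    rcases (deg_le b.2).lt_or_eq with h | h
    · exact Submodule.sub_mem _ (app_mem_lower R (basisElt_mem_lower b h))
        (hlow _ _ (basisElt_mem_lower b h))
    · convert Submodule.zero_mem _
      rw [sub_eq_zero]
      obtain ⟨i, f⟩ := b
      obtain rfl := eq_of_deg_le f h.ge
      rw [← map_gen, hequiv]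
      change R.app _ ((free k e).map f (gen i)) = _
      rw [map_gen, desc_basisElt]
  have hM : IsIso (Φ ≫ R) := isIso_of_sub_mem_lower _ fun c x => by
    have := Submodule.add_mem _ (hR c (Φ.app c x)) (hΦρ c x)
    simpa using this
  exact ⟨R ≫ inv (Φ ≫ R), by rw [← Category.assoc, IsIso.hom_inv_id]⟩

end FIModule

/-! ### From free to projective modules -/

namespace FIModule

open FIPow

variable {m : ℕ} {k : Type u} [CommRing k]

/-- A pointwise split monomorphism of pointwise finite projective modules splits. -/
theorem exists_retraction_of_pointwise {K F : FIModule m k} [Projective K] [Projective F]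
    (hK : PointwiseFinite K) (hF : PointwiseFinite F) (ι : K ⟶ F)
    (hι : ∀ c, ∃ r : F.obj c ⟶ K.obj c, ι.app c ≫ r = 𝟙 _) :
    ∃ r : F ⟶ K, ι ≫ r = 𝟙 _ := by
  obtain ⟨I, d, hd, p, hp⟩ := hK.exists_cover
  obtain ⟨J, e, he, q, hq⟩ := hF.exists_cover
  let s : K ⟶ free k d := Projective.factorThru (𝟙 K) p
  have hs : s ≫ p = 𝟙 K := Projective.factorThru_comp _ _
  let t : F ⟶ free k e := Projective.factorThru (𝟙 F) q
  have ht : t ≫ q = 𝟙 F := Projective.factorThru_comp _ _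
  let D : J ⊕ I → FIPow m := Sum.elim e d
  have hD (c : FIPow m) : Finite (Gen D c) := Finite.of_surjective
    (fun b : Gen e c ⊕ Gen d c =>
      Sum.elim (fun b => (⟨Sum.inl b.1, b.2⟩ : Gen D c)) (fun b => ⟨Sum.inr b.1, b.2⟩) b) (by
      rintro ⟨j | i, f⟩
      · exact ⟨Sum.inl ⟨j, f⟩, rfl⟩
      · exact ⟨Sum.inr ⟨i, f⟩, rfl⟩)
  let inl : free k e ⟶ free k D := desc _ fun j => gen (d := D) (Sum.inl j)
  let inr : free k d ⟶ free k D := desc _ fun i => gen (d := D) (Sum.inr i)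
  let v (b : J ⊕ I) : (free k e).obj (D b) := match b with
    | Sum.inl j => gen j
    | Sum.inr _ => 0
  let w (b : J ⊕ I) : (free k d).obj (D b) := match b with
    | Sum.inl _ => 0
    | Sum.inr i => gen i
  let fst : free k D ⟶ free k e := desc _ v
  let snd : free k D ⟶ free k d := desc _ w
  have hl (j : J) : inl.app (e j) (gen j) = gen (d := D) (Sum.inl j) := desc_gen _ _ j
  have hr (i : I) : inr.app (d i) (gen i) = gen (d := D) (Sum.inr i) := desc_gen _ _ i
  have h11 : inl ≫ fst = 𝟙 _ := free_hom_ext fun j =>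
    (congrArg (fst.app (e j)) (hl j)).trans (desc_gen _ v (Sum.inl j))
  have h12 : inl ≫ snd = 0 := free_hom_ext fun j =>
    (congrArg (snd.app (e j)) (hl j)).trans (desc_gen _ w (Sum.inl j))
  have h21 : inr ≫ fst = 0 := free_hom_ext fun i =>
    (congrArg (fst.app (d i)) (hr i)).trans (desc_gen _ v (Sum.inr i))
  have h22 : inr ≫ snd = 𝟙 _ := free_hom_ext fun i =>
    (congrArg (snd.app (d i)) (hr i)).trans (desc_gen _ w (Sum.inr i))
  -- `s` and `p` split `free k d` into `K` and a complement. `Φ` sends `K` through `ι` into `free k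
  -- e`, and the complement identically into the extra copy of `free k d`.
  let Φ : free k d ⟶ free k D := p ≫ ι ≫ t ≫ inl + (𝟙 _ - p ≫ s) ≫ inr
  have hΦ1 : Φ ≫ fst ≫ q = p ≫ ι := by
    have : Φ ≫ fst = p ≫ ι ≫ t := by simp [Φ, h11, h21]
    rw [← Category.assoc, this, Category.assoc, Category.assoc, ht, Category.comp_id]
  have hΦ2 : Φ ≫ snd = 𝟙 _ - p ≫ s := by simp [Φ, h12, h22]
  have hsΦ : s ≫ Φ = ι ≫ t ≫ inl := by
    simp [Φ, reassoc_of% hs]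
  have hidem : (𝟙 _ - p ≫ s) ≫ (𝟙 _ - p ≫ s) = 𝟙 _ - p ≫ s := by
    simp [reassoc_of% hs]
  obtain ⟨R, hR⟩ := isSplitMono_of_pointwise_free Φ fun c => by
    obtain ⟨r, hr⟩ := hι c
    -- The retraction `r` recovers the part in `K`, and the second summand recovers the complement.
    let ρ := (fst ≫ q).app c ≫ r ≫ s.app c + (snd ≫ (𝟙 _ - p ≫ s)).app c
    have hρ : Φ.app c ≫ ρ = 𝟙 _ := by
      have e1 : Φ.app c ≫ (fst ≫ q).app c = p.app c ≫ ι.app c := by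
        rw [← NatTrans.comp_app, hΦ1, NatTrans.comp_app]
      have e2 : Φ.app c ≫ (snd ≫ (𝟙 _ - p ≫ s)).app c = (𝟙 _ - p ≫ s).app c := by
        rw [← NatTrans.comp_app, ← Category.assoc, hΦ2, hidem]
      rw [Preadditive.comp_add, ← Category.assoc, e1, e2, Category.assoc, reassoc_of% hr]
      simp
    exact ⟨ρ.hom, fun x => congrArg (fun f => f.hom x) hρ⟩
  refine ⟨t ≫ inl ≫ R ≫ p, ?_⟩
  have : ι ≫ t ≫ inl ≫ R ≫ p = (s ≫ Φ) ≫ R ≫ p := by rw [hsΦ]; simp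
  rw [this, Category.assoc, reassoc_of% hR, hs]

lemma projective_obj {F : FIModule m k} [Projective F] (hF : PointwiseFinite F) (c : FIPow m) :
    Projective (F.obj c) := by
  obtain ⟨I, d, hd, p, hp⟩ := hF.exists_cover
  have hs : Projective.factorThru (𝟙 F) p ≫ p = 𝟙 F := Projective.factorThru_comp _ _
  have hfree : Projective ((free k d).obj c) :=
    (IsProjective.iff_projective (Gen d c →₀ k)).1 inferInstance
  let t : Retract (F.obj c) ((free k d).obj c) :=
    ⟨(Projective.factorThru (𝟙 F) p).app c, p.app c, by rw [← NatTrans.comp_app, hs]; rfl⟩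
  exact projective_iff_hasProjectiveDimensionLT_one.2 (t.hasProjectiveDimensionLT 1)

end FIModule

/-! ### Finitistic dimension and the induction -/

/-- Over a ring of finitistic dimension zero, finitely generated modules of finite projective
dimension are projective. -/
lemma projective_of_finitisticDimension_eq_zero {k : Type u} [CommRing k]
    (hk : finitisticDimension k = 0) (T : ModuleCat.{u} k) [hT : Module.Finite k T] (n : ℕ)
    [HasProjectiveDimensionLT T n] : Projective T := by
  have h1 : projectiveDimension T < n := projectiveDimension_lt_iff.2 inferInstance
  have h2 : projectiveDimension T < ⊤ := h1.trans_le le_top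
  have h3 : (projectiveDimension T).unbotD 0 ≤ finitisticDimension k :=
    le_iSup_of_le T (le_iSup_of_le hT (le_iSup_of_le h2 le_rfl))
  rw [hk, nonpos_iff_eq_zero] at h3
  rw [projective_iff_hasProjectiveDimensionLE_zero, ← projectiveDimension_le_iff]
  generalize projectiveDimension T = p at h3
  cases p with
  | bot => exact bot_le
  | coe p => exact_mod_cast h3.le

namespace FIModule

variable {m : ℕ} {k : Type u} [CommRing k]

/-- Pointwise finiteness passes to the kernel of a cover by Noetherianity of `k` alone, so the
induction needs no Noetherian property of `FI^m`-modules. -/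
theorem PointwiseFinite.projective_of_hasProjectiveDimensionLT [IsNoetherianRing k]
    (hk : finitisticDimension k = 0) (n : ℕ) {V : FIModule m k} (hV : PointwiseFinite V)
    (h : HasProjectiveDimensionLT V (n + 1)) : Projective V := by
  induction n generalizing V with
  | zero => exact projective_iff_hasProjectiveDimensionLT_one.2 h
  | succ n ih =>
    obtain ⟨I, d, hd, p, hp⟩ := hV.exists_cover
    let S : ShortComplex (FIModule m k) := ShortComplex.mk _ _ (kernel.condition p)
    have hS : S.ShortExact := { exact := ShortComplex.exact_kernel p }
    have hSc (c : FIPow m) : (S.map ((evaluation _ _).obj c)).ShortExact := hS.map_of_exact _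
    have hKfin : PointwiseFinite (kernel p) := fun c => by
      have := (hSc c).mono_f
      have := free_pointwiseFinite (k := k) (d := d) c
      exact Module.Finite.of_injective ((kernel.ι p).app c).hom
        ((ModuleCat.mono_iff_injective _).1 (hSc c).mono_f)
    have hK : Projective (kernel p) :=
      ih hKfin ((hS.hasProjectiveDimensionLT_X₃_iff n (free_projective (k := k) (d := d))).1 h)
    -- The sequence at `c` is a projective resolution of length one, which is where the finitistic
    -- dimension enters.
    have hVc (c : FIPow m) : Projective (V.obj c) := by
      have := hV c
      have hKc : Projective (S.map ((evaluation _ _).obj c)).X₁ := projective_obj hKfin c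
      have hFc : Projective (S.map ((evaluation _ _).obj c)).X₂ :=
        projective_obj (F := free k d) free_pointwiseFinite c
      have : HasProjectiveDimensionLT (V.obj c) 2 :=
        ((hSc c).hasProjectiveDimensionLT_X₃_iff 0 hFc).2 inferInstance
      exact projective_of_finitisticDimension_eq_zero hk _ 2
    obtain ⟨r, hr⟩ := exists_retraction_of_pointwise hKfin free_pointwiseFinite (kernel.ι p)
      fun c => by
        have : Projective (S.map ((evaluation _ _).obj c)).X₃ := hVc c
        have σ := (hSc c).splittingOfProjective
        exact ⟨σ.r, σ.f_r⟩
    have σ : S.Splitting := ShortComplex.Splitting.ofExactOfRetraction S hS.exact r hr hp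
    have t : Retract V (free k d) := ⟨σ.s, S.g, σ.s_g⟩
    exact projective_iff_hasProjectiveDimensionLT_one.2 (t.hasProjectiveDimensionLT 1)

end FIModule

theorem mainTheorem7 (m : ℕ) (k : Type u) [CommRing k] [IsNoetherianRing k]
    (hk : finitisticDimension k = 0) (V : FIModule m k) (hV : V.IsFinitelyGenerated) :
    projectiveDimension V < ⊤ ↔ Projective V := by
  refine ⟨fun h => ?_, fun h => ?_⟩
  · obtain ⟨n, hn⟩ := (projectiveDimension_ne_top_iff V).1 h.ne
    exact hV.pointwiseFinite.projective_of_hasProjectiveDimensionLT hk n hn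
  · have h1 : projectiveDimension V < (1 : ℕ) := projectiveDimension_lt_iff.2 inferInstance
    exact h1.trans_le le_top
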